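/- Work on a real RAM (unit-cost exact real arithmetic and comparisons, and unit-cost integer addition, subtraction and comparison, with indirectly addressed memory; programs contain only integer constants). There exist a single deterministic program $A$ and an absolute constant $C>0$ with the following properties. The input of $A$ consists of integers $n\ge 1$ and $q\ge 0$, a real $\varepsilon\in(0,1]$, and $q$ points of $\mathbb{R}^n$, and on every input $A$ halts and outputs accept or reject within $\mathrm{poly}(q,n^{\log n})$ steps, i.e. within $K\,(q+n^{\log n})^{K}$ steps for an absolute constant $K$. Moreover, for all $n\ge1$, $\varepsilon\in(0,1]$ and $$q\;\ge\; C\cdot\frac{\sqrt n}{\varepsilon^2},$$ when the $q$ points are i.i.d. samples from a Gaussian distribution $p$ on $\mathbb{R}^n$: * if $p=\mathcal N(0_n,I_n)$, then $A$ outputs accept with probability at least $2/3$; * if $p=\mathcal N(\mu,\Sigma)$ with $\|\mu\|_2>\varepsilon$ and $\Sigma$ any positive semidefinite matrix, then $A$ outputs reject with probability at least $2/3$. Conversely, this sample complexity is optimal: there is an absolute constant $c>0$ such that for all $n\ge 1$ and $\varepsilon\in(0,1]$, every (possibly randomized) procedure which, from $q$ i.i.d. samples of $p$, has the two properties above for this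 $n$ and $\varepsilon$ must use $q\ge c\,\sqrt n/\varepsilon^2$ samples. -/

import Mathlib

open MeasureTheory ProbabilityTheory
open scoped ENNReal

noncomputable section

/-! ### A real RAM with a step count

A machine works on finitely many (per program) integer registers and real registers, and on an
unbounded integer memory and an unbounded real memory which are addressed indirectly, through
integer registers.  A program is one fixed finite object, with integer constants only, which serves
inputs of all sizes.  Integers can only be added and subtracted at unit cost (so that their bit
length grows at most linearly with time); reals admit exact unit-cost arithmetic and comparisons,
and there is no rounding of reals to integers. -/

namespace RealRAM

/-- The contents of the registers and of the memory. -/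
structure State where
  natReg : ℕ → ℕ
  natMem : ℕ → ℕ
  realReg : ℕ → ℝ
  realMem : ℕ → ℝ

/-- Elementary instructions; `d` is always the index of the destination register. -/
inductive Instr where
  | natConst (d c : ℕ)
  | natAdd (d a b : ℕ)
  | natSub (d a b : ℕ)
  | natLoad (d a : ℕ)
  | natStore (a b : ℕ)
  | realConst (d : ℕ) (c : ℤ)
  | realOfNat (d a : ℕ)
  | realAdd (d a b : ℕ)
  | realSub (d a b : ℕ)
  | realMul (d a b : ℕ)
  | realDiv (d a b : ℕ)
  | realLoad (d a : ℕ)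
  | realStore (a b : ℕ)

/-- The effect of an instruction. `natSub` is truncated subtraction, and `realDiv` by zero
yields zero. -/
def Instr.run : Instr → State → State
  | .natConst d c, s => { s with natReg := Function.update s.natReg d c }
  | .natAdd d a b, s =>
      { s with natReg := Function.update s.natReg d (s.natReg a + s.natReg b) }
  | .natSub d a b, s =>
      { s with natReg := Function.update s.natReg d (s.natReg a - s.natReg b) }
  | .natLoad d a, s => { s with natReg := Function.update s.natReg d (s.natMem (s.natReg a)) }
  | .natStore a b, s => { s with natMem := Function.update s.natMem (s.natReg a) (s.natReg b) }
  | .realConst d c, s => { s with realReg := Function.update s.realReg d (c : ℝ) }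
  | .realOfNat d a, s => { s with realReg := Function.update s.realReg d (s.natReg a : ℝ) }
  | .realAdd d a b, s =>
      { s with realReg := Function.update s.realReg d (s.realReg a + s.realReg b) }
  | .realSub d a b, s =>
      { s with realReg := Function.update s.realReg d (s.realReg a - s.realReg b) }
  | .realMul d a b, s =>
      { s with realReg := Function.update s.realReg d (s.realReg a * s.realReg b) }
  | .realDiv d a b, s =>
      { s with realReg := Function.update s.realReg d (s.realReg a / s.realReg b) }
  | .realLoad d a, s => { s with realReg := Function.update s.realReg d (s.realMem (s.natReg a)) }
  | .realStore a b, s => { s with realMem := Function.update s.realMem (s.natReg a) (s.realReg b) }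

/-- Tests: comparison of two integer registers or of two real registers. -/
inductive Test where
  | natLt (a b : ℕ)
  | realLt (a b : ℕ)

/-- The test succeeds in the given state. -/
def Test.Holds : Test → State → Prop
  | .natLt a b, s => s.natReg a < s.natReg b
  | .realLt a b, s => s.realReg a < s.realReg b

/-- Programs: elementary instructions, composed by sequencing, branching and loops. -/
inductive Prog where
  | skip
  | instr (i : Instr)
  | seq (P Q : Prog)
  | ite (c : Test) (P Q : Prog)
  | loop (c : Test) (P : Prog)

/-- `Exec P s t s'`: started in state `s`, the program `P` halts in state `s'` after exactly `t`
steps. Each elementary instruction and each evaluation of a test is one step. -/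
inductive Exec : Prog → State → ℕ → State → Prop where
  | skip (s : State) : Exec .skip s 1 s
  | instr (i : Instr) (s : State) : Exec (.instr i) s 1 (i.run s)
  | seq {P Q : Prog} {s s' s'' : State} {t t' : ℕ} :
      Exec P s t s' → Exec Q s' t' s'' → Exec (.seq P Q) s (t + t') s''
  | iteTrue {c : Test} {P Q : Prog} {s s' : State} {t : ℕ} :
      c.Holds s → Exec P s t s' → Exec (.ite c P Q) s (t + 1) s'
  | iteFalse {c : Test} {P Q : Prog} {s s' : State} {t : ℕ} :
      ¬ c.Holds s → Exec Q s t s' → Exec (.ite c P Q) s (t + 1) s'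
  | loopFalse {c : Test} {P : Prog} {s : State} :
      ¬ c.Holds s → Exec (.loop c P) s 1 s
  | loopTrue {c : Test} {P : Prog} {s s' s'' : State} {t t' : ℕ} :
      c.Holds s → Exec P s t s' → Exec (.loop c P) s' t' s'' →
      Exec (.loop c P) s (t + t' + 1) s''

/-- The machine is deterministic: final state and number of steps are determined. -/
theorem Exec.unique {P : Prog} {s s₁ s₂ : State} {t₁ t₂ : ℕ}
    (h₁ : Exec P s t₁ s₁) (h₂ : Exec P s t₂ s₂) : t₁ = t₂ ∧ s₁ = s₂ := by
  induction h₁ generalizing t₂ s₂ with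
  | skip => cases h₂; exact ⟨rfl, rfl⟩
  | instr => cases h₂; exact ⟨rfl, rfl⟩
  | seq _ _ ih ih' =>
    cases h₂ with
    | seq k k' =>
      obtain ⟨rfl, rfl⟩ := ih k
      obtain ⟨rfl, rfl⟩ := ih' k'
      exact ⟨rfl, rfl⟩
  | iteTrue hc _ ih =>
    cases h₂ with
    | iteTrue _ k => obtain ⟨rfl, rfl⟩ := ih k; exact ⟨rfl, rfl⟩
    | iteFalse hc' _ => exact absurd hc hc'
  | iteFalse hc _ ih =>
    cases h₂ with
    | iteTrue hc' _ => exact absurd hc' hc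
    | iteFalse _ k => obtain ⟨rfl, rfl⟩ := ih k; exact ⟨rfl, rfl⟩
  | loopFalse hc =>
    cases h₂ with
    | loopFalse => exact ⟨rfl, rfl⟩
    | loopTrue hc' _ _ => exact absurd hc' hc
  | loopTrue hc _ _ ih ih' =>
    cases h₂ with
    | loopFalse hc' => exact absurd hc hc'
    | loopTrue _ k k' =>
      obtain ⟨rfl, rfl⟩ := ih k
      obtain ⟨rfl, rfl⟩ := ih' k'
      exact ⟨rfl, rfl⟩

/-- The initial state on input `(n, q, ε, x)`: the dimension `n` and the number `q` of samples in
the integer registers `0` and `1`, the parameter `ε` in the real register `0`, coordinate `j` of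
sample `i` in the cell `j + n * i` of the real memory, and zero everywhere else. -/
def input (n q : ℕ) (ε : ℝ) (x : Fin q → EuclideanSpace ℝ (Fin n)) : State where
  natReg := fun k => if k = 0 then n else if k = 1 then q else 0
  natMem := fun _ => 0
  realReg := fun k => if k = 0 then ε else 0
  realMem := fun k =>
    if h : k < q * n then
      x (finProdFinEquiv.symm ⟨k, h⟩).1 (finProdFinEquiv.symm ⟨k, h⟩).2
    else 0

/-- On the given input the program halts after exactly `t` steps with output `b`, where `true`
(accept) is coded by the value `1`, and `false` (reject) by `0`, in the integer register `0`. -/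
def OutputsIn (P : Prog) (n q : ℕ) (ε : ℝ) (x : Fin q → EuclideanSpace ℝ (Fin n))
    (b : Bool) (t : ℕ) : Prop :=
  ∃ s, Exec P (input n q ε x) t s ∧ s.natReg 0 = b.toNat

/-- The set of sample tuples on which the program halts with output `b`. -/
def outputSet (P : Prog) (n q : ℕ) (ε : ℝ) (b : Bool) :
    Set (Fin q → EuclideanSpace ℝ (Fin n)) :=
  {x | ∃ t, OutputsIn P n q ε x b t}

end RealRAM

/-- The law of `q` i.i.d. samples from the Gaussian with mean `μ` and covariance matrix `S`
on `ℝⁿ`. -/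
def gaussianSamples (n q : ℕ) (μ : EuclideanSpace ℝ (Fin n)) (S : Matrix (Fin n) (Fin n) ℝ) :
    Measure (Fin q → EuclideanSpace ℝ (Fin n)) :=
  Measure.pi fun _ => multivariateGaussian μ S

/-- Gaussian mean testing from `q` samples. Here `pr ν b` is the probability that the procedure
outputs `b` (`true` is accept, `false` is reject) when its sample tuple is drawn from `ν`. -/
def TestsGaussianMean (n q : ℕ) (ε : ℝ)
    (pr : Measure (Fin q → EuclideanSpace ℝ (Fin n)) → Bool → ℝ≥0∞) : Prop :=
  2 / 3 ≤ pr (gaussianSamples n q 0 1) true ∧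
  ∀ (μ : EuclideanSpace ℝ (Fin n)) (S : Matrix (Fin n) (Fin n) ℝ), S.PosSemidef → ε < ‖μ‖ →
    2 / 3 ≤ pr (gaussianSamples n q μ S) false

end

/-! For the upper bound, split the samples into two halves and let `T` be the inner product of their
sums, each over `m ≈ q / 2` samples. Under `N(0, I)`, `T` has second moment `n * m ^ 2`, so by
Chebyshev it is at most of order `√n * m`, which is below `(ε * q) ^ 2` for `q` of order
`√n / ε ^ 2`. Under `N(μ, Σ)` the covariance is unknown, but a one-dimensional Gaussian with mean
`a ≠ 0` has, whatever its variance, density `O(1 / |a|)` near `0`, so it is unlikely to be much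
smaller than `|a|` in absolute value. Applied first to the inner product of `m • μ` with the first
sum and then, conditionally on the first sum, to `T`, this shows that `|T|` is unlikely to be much
smaller than `‖m • μ‖ ^ 2`.

For the lower bound, let `L μ` be the likelihood ratio of `N(μ, I)` to `N(0, I)` for `q` samples,
so that the covariance of `L μ` and `L μ'` under the null is `exp (q * ⟪μ, μ'⟫) - 1`. For a tester
which works for all `2 ^ n` vectors `μ` with entries `± 2 * ε / √n`, the acceptance probability has
covariance at most `-1 / 3` with each `L μ` and variance at most `1 / 4`, so by Cauchy-Schwarz the
mean of `exp (q * ⟪μ, μ'⟫)` over pairs of such vectors is at least `13 / 9`. But that mean is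
`cosh (4 * q * ε ^ 2 / n) ^ n ≤ exp (8 * (q * ε ^ 2) ^ 2 / n)`. -/

namespace RealRAM

/-- The straight-line program which performs the given instructions in order. -/
def block : List Instr → Prog
  | [] => .skip
  | i :: l => .seq (.instr i) (block l)

/-- The Hoare triple for total correctness in exactly `t` steps: started in any state satisfying
`I`, the program `P` halts after `t` steps in a state satisfying `J`. -/
def Triple (I : State → Prop) (P : Prog) (t : ℕ) (J : State → Prop) : Prop :=
  ∀ s, I s → ∃ s', Exec P s t s' ∧ J s'

section Triple

variable {I J L : State → Prop} {P Q : Prog} {c : Test} {t t' : ℕ}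

theorem exec_block (l : List Instr) (s : State) :
    Exec (block l) s (l.length + 1) (l.foldl (fun s i => i.run s) s) := by
  induction l generalizing s with
  | nil => exact Exec.skip s
  | cons i l ih =>
    rw [List.length_cons, add_comm]
    exact Exec.seq (Exec.instr i s) (ih (i.run s))

theorem Triple.block {l : List Instr} (h : ∀ s, I s → J (l.foldl (fun s i => i.run s) s)) :
    Triple I (block l) (l.length + 1) J :=
  fun s hs => ⟨_, exec_block l s, h s hs⟩

theorem Triple.seq (hP : Triple I P t J) (hQ : Triple J Q t' L) :
    Triple I (.seq P Q) (t + t') L := fun s hs => by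
  obtain ⟨s', hP, hs'⟩ := hP s hs
  obtain ⟨s'', hQ, hs''⟩ := hQ s' hs'
  exact ⟨s'', hP.seq hQ, hs''⟩

theorem Triple.ite (hP : Triple (fun s => I s ∧ c.Holds s) P t J)
    (hQ : Triple (fun s => I s ∧ ¬ c.Holds s) Q t J) : Triple I (.ite c P Q) (t + 1) J :=
  fun s hs => by
    by_cases hc : c.Holds s
    · obtain ⟨s', hP, hs'⟩ := hP s ⟨hs, hc⟩
      exact ⟨s', .iteTrue hc hP, hs'⟩
    · obtain ⟨s', hQ, hs'⟩ := hQ s ⟨hs, hc⟩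
      exact ⟨s', .iteFalse hc hQ, hs'⟩

theorem Triple.loop {I : ℕ → State → Prop} {m : ℕ} (hc : ∀ k s, I k s → (c.Holds s ↔ k < m))
    (hP : ∀ k < m, Triple (I k) P t (I (k + 1))) :
    Triple (I 0) (.loop c P) ((t + 1) * m + 1) (I m) := by
  suffices h : ∀ r k, k + r = m → Triple (I k) (.loop c P) ((t + 1) * r + 1) (I m) from
    h m 0 (zero_add m)
  intro r
  induction r with
  | zero =>
    rintro k rfl s hs
    exact ⟨s, .loopFalse (by simp [hc k s hs]), hs⟩
  | succ r ih =>
    intro k hk s hs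
    obtain ⟨s', hP, hs'⟩ := hP k (by lia) s hs
    obtain ⟨s'', hloop, hs''⟩ := ih (k + 1) (by lia) s' hs'
    refine ⟨s'', ?_, hs''⟩
    convert! Exec.loopTrue ((hc k s hs).2 (by lia)) hP hloop using 1
    ring

end Triple

/-- The inner loop of `meanTester`, which runs through the pairs of samples `2 * l`, `2 * l + 1`. -/
def innerLoop : Prog :=
  .loop (.natLt 3 1) (block [.realLoad 4 4, .realAdd 2 2 4, .natAdd 4 4 0,
    .realLoad 4 4, .realAdd 3 3 4, .natAdd 4 4 0, .natAdd 3 3 6])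

/-- The outer loop of `meanTester`, which runs through the coordinates. -/
def outerLoop : Prog :=
  .loop (.natLt 2 0)
    (.seq (block [.natConst 4 0, .natAdd 4 4 2, .natConst 3 1, .realConst 2 0, .realConst 3 0])
      (.seq innerLoop (block [.realMul 2 2 3, .realAdd 1 1 2, .natAdd 2 2 5])))

/-- The tester of the theorem. With `m = q / 2`, it computes the inner product `T` of the sum of the
samples `0, 2, …, 2 * m - 2` with the sum of the samples `1, 3, …, 2 * m - 1`, one coordinate at a
time, and it rejects if and only if `|T| > (ε * q / 36) ^ 2`; both sides are squared to do without
the absolute value.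

Integer registers: `0` is `n`, `1` is `q`, `2` is the coordinate, `3` is `2 * l + 1` in the `l`-th
pass of the inner loop, `4` is the address of the next entry, and `5`, `6` hold the constants `1`,
`2`. Real registers: `0` is `ε`, `1` accumulates `T`, `2` and `3` accumulate the coordinates of the
two sums, and `4` is scratch. -/
def meanTester : Prog :=
  .seq (block [.natConst 5 1, .natConst 6 2])
    (.seq outerLoop
      (.seq
        (block [.realOfNat 4 1, .realMul 0 0 4, .realConst 4 36, .realDiv 0 0 4, .realMul 0 0 0,
          .realMul 0 0 0, .realMul 1 1 1])
        (.ite (.realLt 0 1) (block [.natConst 0 0]) (block [.natConst 0 1]))))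

/-- The sum of coordinate `j` of the samples `e, e + 2, …, e + 2 * (m - 1)`, read off from a memory
which holds coordinate `j` of sample `i` in the cell `j + n * i`. -/
noncomputable def memSum (mem : ℕ → ℝ) (n e j m : ℕ) : ℝ :=
  ∑ l ∈ Finset.range m, mem (j + n * (2 * l + e))

/-- The contribution of the first `k` coordinates to the test statistic of `meanTester`. -/
noncomputable def memStatistic (mem : ℕ → ℝ) (n m k : ℕ) : ℝ :=
  ∑ j ∈ Finset.range k, memSum mem n 0 j m * memSum mem n 1 j m

/-- The invariant of the outer loop of `meanTester` at coordinate `j`. -/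
structure OuterInvariant (n q : ℕ) (ε : ℝ) (mem : ℕ → ℝ) (j : ℕ) (s : State) : Prop where
  dim : s.natReg 0 = n
  samples : s.natReg 1 = q
  coord : s.natReg 2 = j
  one : s.natReg 5 = 1
  two : s.natReg 6 = 2
  eps : s.realReg 0 = ε
  statistic : s.realReg 1 = memStatistic mem n (q / 2) j
  memory : s.realMem = mem

/-- The invariant of the inner loop of `meanTester` at coordinate `j`, after `l` passes. -/
structure InnerInvariant (n q : ℕ) (ε : ℝ) (mem : ℕ → ℝ) (j l : ℕ) (s : State) : Prop
    extends OuterInvariant n q ε mem j s where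
  counter : s.natReg 3 = 2 * l + 1
  address : s.natReg 4 = j + n * (2 * l)
  evenSum : s.realReg 2 = memSum mem n 0 j l
  oddSum : s.realReg 3 = memSum mem n 1 j l

section meanTester

variable {n q : ℕ} {ε : ℝ} {mem : ℕ → ℝ}

theorem triple_innerLoop (j : ℕ) :
    Triple (InnerInvariant n q ε mem j 0) innerLoop (9 * (q / 2) + 1)
      (InnerInvariant n q ε mem j (q / 2)) := by
  refine Triple.loop (fun l s h => ?_) fun l _ => Triple.block fun s h => ?_
  · rw [Test.Holds, h.counter, h.samples]
    lia
  · constructor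
    · constructor <;> simp [Instr.run, h.dim, h.samples, h.coord, h.one, h.two, h.eps, h.memory,
        h.statistic]
    · simp [Instr.run, h.counter, h.two, mul_add, add_right_comm]
    · simp [Instr.run, h.address, h.dim, mul_add, mul_two, add_assoc]
    · simp [Instr.run, h.evenSum, h.address, h.memory, memSum, Finset.sum_range_succ]
    · simp [Instr.run, h.oddSum, h.address, h.memory, h.dim, memSum, Finset.sum_range_succ,
        mul_add, add_assoc]

theorem triple_outerLoop :
    Triple (OuterInvariant n q ε mem 0) outerLoop ((9 * (q / 2) + 12) * n + 1)
      (OuterInvariant n q ε mem n) := by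
  have start (j : ℕ) : Triple (OuterInvariant n q ε mem j)
      (block [.natConst 4 0, .natAdd 4 4 2, .natConst 3 1, .realConst 2 0, .realConst 3 0]) 6
      (InnerInvariant n q ε mem j 0) := .block fun s h => by
    constructor
    · constructor <;> simp [Instr.run, h.dim, h.samples, h.coord, h.one, h.two, h.eps, h.memory,
        h.statistic]
    all_goals simp [Instr.run, h.coord, memSum]
  have update (j : ℕ) : Triple (InnerInvariant n q ε mem j (q / 2))
      (block [.realMul 2 2 3, .realAdd 1 1 2, .natAdd 2 2 5]) 4
      (OuterInvariant n q ε mem (j + 1)) := .block fun s h => by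
    constructor <;> simp [Instr.run, h.dim, h.samples, h.coord, h.one, h.two, h.eps, h.memory,
      h.statistic, h.evenSum, h.oddSum, memStatistic, Finset.sum_range_succ]
  convert! Triple.loop (fun j s h => ?_) fun j _ =>
    (start j).seq ((triple_innerLoop j).seq (update j)) using 1
  · ring
  · rw [Test.Holds, h.coord, h.dim]

theorem triple_meanTester :
    Triple (fun s => s.natReg 0 = n ∧ s.natReg 1 = q ∧ s.natReg 2 = 0 ∧ s.realReg 0 = ε ∧
      s.realReg 1 = 0 ∧ s.realMem = mem) meanTester ((9 * (q / 2) + 12) * n + 15)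
      (fun s => s.natReg 0 =
        (decide (|memStatistic mem n (q / 2) n| ≤ (ε * q / 36) ^ 2)).toNat) := by
  have start : Triple (fun s => s.natReg 0 = n ∧ s.natReg 1 = q ∧ s.natReg 2 = 0 ∧
      s.realReg 0 = ε ∧ s.realReg 1 = 0 ∧ s.realMem = mem)
      (block [.natConst 5 1, .natConst 6 2]) 3 (OuterInvariant n q ε mem 0) :=
    .block fun s ⟨h0, h1, h2, hε, hT, hmem⟩ => by
      constructor <;> simp [Instr.run, h0, h1, h2, hε, hT, hmem, memStatistic]
  have squares : Triple (OuterInvariant n q ε mem n)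
      (block [.realOfNat 4 1, .realMul 0 0 4, .realConst 4 36, .realDiv 0 0 4, .realMul 0 0 0,
        .realMul 0 0 0, .realMul 1 1 1]) 8
      (fun s => s.realReg 0 = ((ε * q / 36) ^ 2) ^ 2 ∧
        s.realReg 1 = memStatistic mem n (q / 2) n ^ 2) := .block fun s h => by
    simp [Instr.run, h.samples, h.eps, h.statistic, pow_two]
  convert! start.seq (triple_outerLoop.seq (squares.seq (Triple.ite (c := .realLt 0 1)
    (.block (l := [.natConst 0 0]) fun s h => ?_) (.block (l := [.natConst 0 1])
    fun s h => ?_)))) using 1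
  · simp only [List.length_cons, List.length_nil]
    ring
  · obtain ⟨⟨h0, h1⟩, h⟩ := h
    rw [Test.Holds, h0, h1, sq_lt_sq, abs_sq] at h
    simp [Instr.run, decide_eq_false h.not_ge]
  · obtain ⟨⟨h0, h1⟩, h⟩ := h
    rw [Test.Holds, h0, h1, sq_lt_sq, abs_sq, not_lt] at h
    simp [Instr.run, decide_eq_true h]

end meanTester

/-- The indices `e, e + 2, …, e + 2 * (q / 2 - 1)`; when `q` is odd, the last index is in neither of
the two sets. -/
def parityIndices (q : ℕ) (e : Fin 2) : Finset (Fin q) :=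
  Finset.univ.map ⟨fun l : Fin (q / 2) => ⟨2 * l + e, by lia⟩, fun a b h => by
    simp only [Fin.mk.injEq] at h
    lia⟩

/-- The test statistic: the inner product of the sums of the samples over the two parity classes. -/
noncomputable def crossStatistic {n q : ℕ} (x : Fin q → EuclideanSpace ℝ (Fin n)) : ℝ :=
  inner ℝ (∑ i ∈ parityIndices q 0, x i) (∑ i ∈ parityIndices q 1, x i)

section input

variable {n q : ℕ} {ε : ℝ} {x : Fin q → EuclideanSpace ℝ (Fin n)}

theorem input_realMem (i : Fin q) (j : Fin n) : (input n q ε x).realMem (j + n * i) = x i j := by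
  have hlt : (j + n * i : ℕ) < q * n := (finProdFinEquiv (i, j)).2
  have h : (finProdFinEquiv.symm ⟨j + n * i, hlt⟩ : Fin q × Fin n) = (i, j) :=
    finProdFinEquiv.symm_apply_apply (i, j)
  simp only [input, dif_pos hlt, h]

theorem memSum_input (e : Fin 2) (j : Fin n) :
    memSum (input n q ε x).realMem n e j (q / 2) = (∑ i ∈ parityIndices q e, x i) j := by
  rw [memSum, parityIndices, Finset.sum_map, WithLp.ofLp_sum, Finset.sum_apply, Finset.sum_range]
  exact Finset.sum_congr rfl fun l _ => input_realMem ⟨2 * l + e, _⟩ j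

theorem memStatistic_input :
    memStatistic (input n q ε x).realMem n (q / 2) n = crossStatistic x := by
  rw [memStatistic, crossStatistic, PiLp.inner_apply, Finset.sum_range]
  refine Finset.sum_congr rfl fun j _ => ?_
  rw [RCLike.inner_apply, conj_trivial, mul_comm, ← memSum_input (ε := ε),
    ← memSum_input (ε := ε)]
  rfl

theorem meanTester_outputsIn (n q : ℕ) (ε : ℝ) (x : Fin q → EuclideanSpace ℝ (Fin n)) :
    OutputsIn meanTester n q ε x (decide (|crossStatistic x| ≤ (ε * q / 36) ^ 2))
      ((9 * (q / 2) + 12) * n + 15) := by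
  rw [← memStatistic_input (ε := ε)]
  exact triple_meanTester (input n q ε x) (by simp [input])

theorem outputSet_meanTester (n q : ℕ) (ε : ℝ) (b : Bool) :
    outputSet meanTester n q ε b =
      {x | decide (|crossStatistic x| ≤ (ε * q / 36) ^ 2) = b} := by
  ext x
  constructor
  · rintro ⟨t, s, hs, hb⟩
    obtain ⟨s', hs', hb'⟩ := meanTester_outputsIn n q ε x
    obtain ⟨-, rfl⟩ := hs.unique hs'
    exact Function.LeftInverse.injective Bool.ofNat_toNat (hb'.symm.trans hb)
  · rintro rfl
    exact ⟨_, meanTester_outputsIn n q ε x⟩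

end input

end RealRAM

section AntiConcentration

theorem abs_sub_mul_gaussianPDFReal_le (μ : ℝ) (v : NNReal) (x : ℝ) :
    |x - μ| * gaussianPDFReal μ v x ≤ 1 / 2 := by
  rcases eq_or_ne v 0 with rfl | hv
  · simp
  have hv : (0 : ℝ) < v := by positivity
  set w := √(v : ℝ) with hw
  have hw0 : 0 < w := Real.sqrt_pos.2 hv
  set u := |x - μ| / w with hu
  have hu_exp : u ≤ Real.exp (u ^ 2 / 2) := by
    nlinarith [Real.add_one_le_exp (u ^ 2 / 2), sq_nonneg (u - 1)]
  have hexponent : -(x - μ) ^ 2 / (2 * v) = -(u ^ 2 / 2) := by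
    rw [hu, div_pow, sq_abs, hw, Real.sq_sqrt hv.le]
    ring
  have hpi : 2 * w ≤ √(2 * Real.pi * v) := by
    rw [Real.sqrt_mul (by positivity)]
    gcongr
    exact Real.le_sqrt_of_sq_le (by nlinarith [Real.pi_gt_three])
  calc |x - μ| * gaussianPDFReal μ v x
      = u * w * ((√(2 * Real.pi * v))⁻¹ * (Real.exp (u ^ 2 / 2))⁻¹) := by
        rw [gaussianPDFReal, hexponent, Real.exp_neg, hu, div_mul_cancel₀ _ hw0.ne']
    _ ≤ Real.exp (u ^ 2 / 2) * w * ((2 * w)⁻¹ * (Real.exp (u ^ 2 / 2))⁻¹) := by gcongr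
    _ = 1 / 2 := by field_simp

theorem gaussianReal_abs_le_mul_abs_mean {a : ℝ} (ha : a ≠ 0) (v : NNReal) (s : ℝ) :
    gaussianReal a v {x | |x| ≤ s * |a|} ≤ ENNReal.ofReal (2 * s) := by
  have ha' : 0 < |a| := abs_pos.2 ha
  rcases le_or_gt (1 / 2) s with hs | hs
  · exact prob_le_one.trans (ENNReal.one_le_ofReal.2 (by linarith))
  have far : ∀ x, |x| ≤ s * |a| → |a| / 2 < |x - a| := fun x hx => by
    have := abs_sub_abs_le_abs_sub a x
    rw [abs_sub_comm a x] at this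
    nlinarith
  rcases eq_or_ne v 0 with rfl | hv
  · rw [gaussianReal_zero_var, Measure.dirac_apply' _
      (measurableSet_le (by fun_prop) (by fun_prop)), Set.indicator_of_notMem]
    · exact zero_le
    · intro h
      have := far a h
      simp only [sub_self, abs_zero] at this
      linarith
  have hIcc : {x : ℝ | |x| ≤ s * |a|} = Set.Icc (-(s * |a|)) (s * |a|) := by ext; simp [abs_le]
  rw [gaussianReal_apply a hv]
  calc ∫⁻ x in {x | |x| ≤ s * |a|}, gaussianPDF a v x
      ≤ ∫⁻ _ in {x | |x| ≤ s * |a|}, ENNReal.ofReal (1 / |a|) := by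
        refine setLIntegral_mono' (measurableSet_le (by fun_prop) (by fun_prop)) fun x hx => ?_
        refine ENNReal.ofReal_le_ofReal ((le_div_iff₀' ha').2 ?_)
        nlinarith [abs_sub_mul_gaussianPDFReal_le a v x, far x hx, gaussianPDFReal_nonneg a v x]
    _ = ENNReal.ofReal (2 * s) := by
        rw [setLIntegral_const, hIcc, Real.volume_Icc, ← ENNReal.ofReal_mul (by positivity)]
        congr 1
        field_simp
        ring

end AntiConcentration

section Inner

variable {E : Type*}
  [NormedAddCommGroup E] [InnerProductSpace ℝ E] [FiniteDimensional ℝ E]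
  [MeasurableSpace E] [BorelSpace E]

theorem measure_abs_inner_le_mul_abs_inner_mean (ρ : Measure E) [IsGaussian ρ] {y : E}
    (hy : inner ℝ y (∫ x, x ∂ρ) ≠ 0) (s : ℝ) :
    ρ {x | |inner ℝ y x| ≤ s * |inner ℝ y (∫ x, x ∂ρ)|} ≤ ENNReal.ofReal (2 * s) := by
  have hmean : ∫ x, innerSL ℝ y x ∂ρ = inner ℝ y (∫ x, x ∂ρ) :=
    (innerSL ℝ y).integral_comp_comm IsGaussian.integrable_fun_id
  have hlaw := IsGaussian.map_eq_gaussianReal (μ := ρ) (innerSL ℝ y)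
  rw [hmean] at hlaw
  have := gaussianReal_abs_le_mul_abs_mean hy (Var[innerSL ℝ y; ρ]).toNNReal s
  rwa [← hlaw, Measure.map_apply (by fun_prop) (measurableSet_le (by fun_prop) (by fun_prop))]
    at this

theorem prod_abs_inner_le (ρ ρ' : Measure E) [IsGaussian ρ] [IsGaussian ρ']
    (h : inner ℝ (∫ x, x ∂ρ) (∫ y, y ∂ρ') ≠ 0) {s : ℝ} (hs : 0 < s) :
    (ρ.prod ρ') {z | |inner ℝ z.1 z.2| ≤ s ^ 2 * |inner ℝ (∫ x, x ∂ρ) (∫ y, y ∂ρ')|} ≤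
      ENNReal.ofReal (4 * s) := by
  set M := ∫ x, x ∂ρ
  set M' := ∫ y, y ∂ρ'
  set A := {x : E | |inner ℝ M' x| ≤ s * |inner ℝ M' M|}
  have hA : MeasurableSet A := measurableSet_le (by fun_prop) (by fun_prop)
  have hρ : ρ A ≤ ENNReal.ofReal (2 * s) :=
    measure_abs_inner_le_mul_abs_inner_mean ρ (by rwa [real_inner_comm]) s
  have hρ' : ∀ x ∉ A, ρ' {y | |inner ℝ x y| ≤ s ^ 2 * |inner ℝ M M'|} ≤
      ENNReal.ofReal (2 * s) := fun x hx => by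
    have hx : s * |inner ℝ M M'| < |inner ℝ x M'| := by
      simpa [A, real_inner_comm] using hx
    have hpos : 0 < s * |inner ℝ M M'| := mul_pos hs (abs_pos.2 h)
    have hle : s ^ 2 * |inner ℝ M M'| ≤ s * |inner ℝ x M'| := by
      rw [sq, mul_assoc]
      gcongr
    exact (measure_mono fun y (hy : |inner ℝ x y| ≤ _) => hy.trans hle).trans
      (measure_abs_inner_le_mul_abs_inner_mean ρ' (abs_pos.1 (hpos.trans hx)) s)
  rw [Measure.prod_apply (measurableSet_le (by fun_prop) (by fun_prop))]
  calc ∫⁻ x, ρ' {y | |inner ℝ x y| ≤ s ^ 2 * |inner ℝ M M'|} ∂ρ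
      ≤ ∫⁻ x, (A.indicator 1 x + ENNReal.ofReal (2 * s)) ∂ρ := by
        refine lintegral_mono fun x => ?_
        by_cases hx : x ∈ A
        · simpa [hx] using prob_le_one.trans le_self_add
        · simpa [hx] using hρ' x hx
    _ = ρ A + ENNReal.ofReal (2 * s) := by
        rw [lintegral_add_right _ measurable_const, lintegral_indicator_one hA]
        simp
    _ ≤ ENNReal.ofReal (2 * s) + ENNReal.ofReal (2 * s) := by gcongr
    _ = ENNReal.ofReal (4 * s) := by
        rw [← ENNReal.ofReal_add (by positivity) (by positivity)]
        congr 1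
        ring

end Inner

section SecondMoment

variable {E : Type*} [NormedAddCommGroup E] [InnerProductSpace ℝ E]

theorem sum_enorm_inner_sq {ι : Type*} [Fintype ι] (b : OrthonormalBasis ι ℝ E) (x : E) :
    ∑ i, ‖inner ℝ (b i) x‖ₑ ^ 2 = ‖x‖ₑ ^ 2 := by
  simp_rw [← ofReal_norm, ← ENNReal.ofReal_pow (norm_nonneg _)]
  rw [← ENNReal.ofReal_sum_of_nonneg fun _ _ => sq_nonneg _, b.sum_sq_norm_inner_right]

variable [FiniteDimensional ℝ E] [MeasurableSpace E] [BorelSpace E]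

theorem lintegral_prod_enorm_inner_sq {ρ ρ' : Measure E} [SFinite ρ'] {σ τ : ℝ≥0∞}
    (hρ : ∀ v, ∫⁻ x, ‖inner ℝ v x‖ₑ ^ 2 ∂ρ = σ * ‖v‖ₑ ^ 2)
    (hρ' : ∀ v, ∫⁻ y, ‖inner ℝ v y‖ₑ ^ 2 ∂ρ' = τ * ‖v‖ₑ ^ 2) :
    ∫⁻ z, ‖inner ℝ z.1 z.2‖ₑ ^ 2 ∂(ρ.prod ρ') = τ * (Module.finrank ℝ E * σ) := by
  let b := stdOrthonormalBasis ℝ E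
  calc ∫⁻ z, ‖inner ℝ z.1 z.2‖ₑ ^ 2 ∂(ρ.prod ρ')
      = ∫⁻ x, τ * ‖x‖ₑ ^ 2 ∂ρ := by
        rw [lintegral_prod _ (by fun_prop)]
        simp only [hρ']
    _ = τ * ∑ i, ∫⁻ x, ‖inner ℝ (b i) x‖ₑ ^ 2 ∂ρ := by
        rw [lintegral_const_mul _ (by fun_prop), ← lintegral_finsetSum _ fun i _ => by fun_prop]
        simp only [sum_enorm_inner_sq]
    _ = τ * (Module.finrank ℝ E * σ) := by
        have hb (i) : ‖b i‖ₑ = 1 := by rw [← ofReal_norm, b.norm_eq_one, ENNReal.ofReal_one]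
        simp [hρ, hb]

theorem measure_lt_abs_le {Ω : Type*} [MeasurableSpace Ω] (P : Measure Ω) {f : Ω → ℝ}
    (hf : AEMeasurable f P) {t : ℝ} (ht : 0 < t) :
    P {ω | t < |f ω|} ≤ (∫⁻ ω, ‖f ω‖ₑ ^ 2 ∂P) / ENNReal.ofReal (t ^ 2) := by
  refine le_trans (measure_mono fun ω hω => ?_) (meas_ge_le_lintegral_div (by fun_prop)
    (by positivity) ENNReal.ofReal_ne_top)
  rw [Set.mem_ofPred_eq, ← ofReal_norm, ← ENNReal.ofReal_pow (norm_nonneg _)]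
  refine ENNReal.ofReal_le_ofReal ?_
  have : t < ‖f ω‖ := hω
  gcongr

end SecondMoment

theorem iIndepFun_pi_eval {ι E : Type*} [Fintype ι] [MeasurableSpace E] (ν : Measure E)
    [IsProbabilityMeasure ν] :
    iIndepFun (fun (i : ι) (x : ι → E) => x i) (Measure.pi fun _ => ν) :=
  iIndepFun_pi (X := fun _ => id) fun _ => aemeasurable_id

section SumLaw

variable {E ι : Type*} [NormedAddCommGroup E] [MeasurableSpace E] [Fintype ι]

/-- The law of the sum over `I` of i.i.d. samples from `ν`. -/
noncomputable def sumLaw (ν : Measure E) (I : Finset ι) : Measure E :=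
  (Measure.pi fun _ : ι => ν).map fun x => ∑ i ∈ I, x i

variable [BorelSpace E] [SecondCountableTopology E] (ν : Measure E)

theorem map_pi_prodMk_sum [IsProbabilityMeasure ν] {I J : Finset ι} (h : Disjoint I J) :
    (Measure.pi fun _ => ν).map (fun x : ι → E => (∑ i ∈ I, x i, ∑ i ∈ J, x i)) =
      (sumLaw ν I).prod (sumLaw ν J) := by
  have hsum (I : Finset ι) : Measurable fun y : I → E => ∑ i, y i := by fun_prop
  have hindep := ((iIndepFun_pi_eval ν).indepFun_finset I J h measurable_pi_apply).comp
    (hsum I) (hsum J)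
  simp only [Function.comp_def, Finset.sum_coe_sort I fun _ => _,
    Finset.sum_coe_sort J fun _ => _] at hindep
  exact (indepFun_iff_map_prod_eq_prod_map_map (by fun_prop) (by fun_prop)).1 hindep

variable [NormedSpace ℝ E]

theorem integral_sumLaw [CompleteSpace E] [IsProbabilityMeasure ν] (h : Integrable id ν)
    (I : Finset ι) :
    ∫ x, x ∂(sumLaw ν I) = I.card • ∫ x, x ∂ν := by
  have hint (i : ι) : Integrable (fun x : ι → E => x i) (Measure.pi fun _ => ν) :=
    integrable_eval h
  rw [sumLaw, integral_map (by fun_prop) (by fun_prop), integral_finsetSum _ fun i _ => hint i]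
  simp [integral_eval]

variable [IsGaussian ν]

instance isGaussian_sumLaw [CompleteSpace E] (I : Finset ι) : IsGaussian (sumLaw ν I) := by
  have h := iIndepFun.hasGaussianLaw_fun_sum (X := fun (i : I) (x : ι → E) => x i)
    (fun i => (measurePreserving_eval (fun _ => ν) (i : ι)).hasLaw.hasGaussianLaw)
    ((iIndepFun_pi_eval ν).precomp Subtype.val_injective)
  simp only [Finset.sum_coe_sort I fun _ => _] at h
  exact h.isGaussian_map

theorem variance_sumLaw (L : StrongDual ℝ E) (I : Finset ι) :
    Var[L; sumLaw ν I] = I.card * Var[L; ν] := by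
  have hL (i : ι) : MemLp (fun x : ι → E => L (x i)) 2 (Measure.pi fun _ => ν) :=
    (IsGaussian.memLp_dual ν L 2 (by simp)).comp_measurePreserving
      (measurePreserving_eval (fun _ => ν) i)
  have hvar (i : ι) : Var[fun x : ι → E => L (x i); Measure.pi fun _ => ν] = Var[L; ν] :=
    (measurePreserving_eval (fun _ => ν) i).variance_fun_comp (by fun_prop)
  have hsum : L ∘ (fun x : ι → E => ∑ i ∈ I, x i) = ∑ i ∈ I, fun x : ι → E => L (x i) := by
    ext x; simp
  rw [sumLaw, variance_map (by fun_prop) (by fun_prop), hsum, IndepFun.variance_sum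
    (fun i _ => hL i) fun i _ j _ hij =>
      ((iIndepFun_pi_eval ν).indepFun hij).comp L.measurable L.measurable]
  simp [hvar]

end SumLaw

theorem lintegral_enorm_inner_sq_sumLaw_stdGaussian {E ι : Type*} [NormedAddCommGroup E]
    [InnerProductSpace ℝ E] [FiniteDimensional ℝ E] [MeasurableSpace E] [BorelSpace E]
    [Fintype ι] (I : Finset ι) (v : E) :
    ∫⁻ x, ‖inner ℝ v x‖ₑ ^ 2 ∂(sumLaw (stdGaussian E) I) = I.card * ‖v‖ₑ ^ 2 := by
  have hmean : ∫ x, innerSL ℝ v x ∂(sumLaw (stdGaussian E) I) = 0 := by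
    rw [(innerSL ℝ v).integral_comp_comm IsGaussian.integrable_fun_id,
      integral_sumLaw _ IsGaussian.integrable_id, integral_id_stdGaussian, smul_zero, map_zero]
  have hvar := variance_sumLaw (stdGaussian E) (innerSL ℝ v) I
  rw [variance_dual_stdGaussian, innerSL_apply_norm] at hvar
  have := ofReal_variance (IsGaussian.memLp_dual (sumLaw (stdGaussian E) I) (innerSL ℝ v) 2
    (by simp))
  rw [hvar, evariance, hmean] at this
  simpa [ENNReal.ofReal_mul, ENNReal.ofReal_pow] using this.symm

theorem ofReal_one_third : ENNReal.ofReal (1 / 3) = 1 / 3 := by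
  rw [ENNReal.ofReal_div_of_pos three_pos, ENNReal.ofReal_one, ENNReal.ofReal_ofNat]

theorem two_thirds_le_measure_compl {Ω : Type*} [MeasurableSpace Ω] {P : Measure Ω}
    [IsProbabilityMeasure P] {A : Set Ω} (hA : MeasurableSet A) (h : P A ≤ 1 / 3) :
    2 / 3 ≤ P Aᶜ := by
  rw [prob_compl_eq_one_sub hA]
  refine le_trans (ENNReal.le_sub_of_add_le_right (by simp) ?_) (tsub_le_tsub_left h 1)
  rw [← ENNReal.add_div]
  norm_num

instance isProbabilityMeasure_gaussianSamples (n q : ℕ) (μ : EuclideanSpace ℝ (Fin n))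
    (S : Matrix (Fin n) (Fin n) ℝ) : IsProbabilityMeasure (gaussianSamples n q μ S) := by
  unfold gaussianSamples
  infer_instance

namespace RealRAM

theorem card_parityIndices (q : ℕ) (e : Fin 2) : (parityIndices q e).card = q / 2 := by
  simp [parityIndices]

theorem disjoint_parityIndices (q : ℕ) : Disjoint (parityIndices q 0) (parityIndices q 1) := by
  refine Finset.disjoint_left.2 fun a h0 h1 => ?_
  obtain ⟨l, -, rfl⟩ := Finset.mem_map.1 h0
  obtain ⟨k, -, hk⟩ := Finset.mem_map.1 h1
  have : 2 * k.val + 1 = 2 * l.val := congrArg Fin.val hk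
  lia

variable {n q : ℕ} {ε : ℝ}

@[fun_prop]
theorem measurable_crossStatistic :
    Measurable (crossStatistic : (Fin q → EuclideanSpace ℝ (Fin n)) → ℝ) := by
  unfold crossStatistic
  fun_prop

theorem pi_crossStatistic (ν : Measure (EuclideanSpace ℝ (Fin n))) [IsProbabilityMeasure ν]
    {A : Set ℝ} (hA : MeasurableSet A) :
    Measure.pi (fun _ : Fin q => ν) (crossStatistic ⁻¹' A) =
      ((sumLaw ν (parityIndices q 0)).prod (sumLaw ν (parityIndices q 1)))
        ((fun z => inner ℝ z.1 z.2) ⁻¹' A) := by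
  rw [← map_pi_prodMk_sum ν (disjoint_parityIndices q),
    Measure.map_apply (by fun_prop) (continuous_inner.measurable hA)]
  rfl

theorem gaussianSamples_lt_abs_crossStatistic {t : ℝ} (ht : 0 < t)
    (hnt : 3 * (n * ((q / 2 : ℕ) : ℝ) ^ 2) ≤ t ^ 2) :
    gaussianSamples n q 0 1 {x | t < |crossStatistic x|} ≤ 1 / 3 := by
  rw [gaussianSamples, multivariateGaussian_zero_one]
  set ν := stdGaussian (EuclideanSpace ℝ (Fin n))
  set ρ : Fin 2 → Measure (EuclideanSpace ℝ (Fin n)) := fun e => sumLaw ν (parityIndices q e)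
  have hsecond : ∫⁻ z, ‖inner ℝ z.1 z.2‖ₑ ^ 2 ∂((ρ 0).prod (ρ 1)) =
      ENNReal.ofReal (n * ((q / 2 : ℕ) : ℝ) ^ 2) := by
    rw [lintegral_prod_enorm_inner_sq (lintegral_enorm_inner_sq_sumLaw_stdGaussian _)
      (lintegral_enorm_inner_sq_sumLaw_stdGaussian _), finrank_euclideanSpace_fin,
      card_parityIndices, card_parityIndices]
    norm_cast
    ring
  calc Measure.pi (fun _ => ν) {x | t < |crossStatistic x|}
      = ((ρ 0).prod (ρ 1)) {z | t < |inner ℝ z.1 z.2|} :=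
        pi_crossStatistic ν (A := {r | t < |r|}) (measurableSet_lt (by fun_prop) (by fun_prop))
    _ ≤ ENNReal.ofReal (n * ((q / 2 : ℕ) : ℝ) ^ 2) / ENNReal.ofReal (t ^ 2) :=
        (measure_lt_abs_le _ (by fun_prop) ht).trans_eq (by rw [hsecond])
    _ ≤ 1 / 3 := by
        rw [← ENNReal.ofReal_div_of_pos (by positivity), ← ofReal_one_third]
        refine ENNReal.ofReal_le_ofReal ((div_le_iff₀ (by positivity)).2 ?_)
        linarith

theorem gaussianSamples_abs_crossStatistic_le {μ : EuclideanSpace ℝ (Fin n)}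
    (S : Matrix (Fin n) (Fin n) ℝ) (hq : 2 ≤ q) (hε : 0 < ε) (hμ : ε < ‖μ‖) :
    gaussianSamples n q μ S {x | |crossStatistic x| ≤ (ε * q / 36) ^ 2} ≤ 1 / 3 := by
  set ν := multivariateGaussian μ S
  set m : ℝ := ((q / 2 : ℕ) : ℝ)
  have hm : 0 < m := Nat.cast_pos.2 (by lia)
  have hqm : (q : ℝ) ≤ 3 * m := by
    rw [← Nat.cast_ofNat, ← Nat.cast_mul]
    exact Nat.cast_le.2 (by lia)
  have hmean (e : Fin 2) : ∫ x, x ∂(sumLaw ν (parityIndices q e)) = m • μ := by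
    rw [integral_sumLaw ν IsGaussian.integrable_id, card_parityIndices,
      integral_id_multivariateGaussian, Nat.cast_smul_eq_nsmul]
  have hinner : inner ℝ (m • μ) (m • μ) = (m * ‖μ‖) ^ 2 := by
    rw [real_inner_self_eq_norm_sq, norm_smul, Real.norm_of_nonneg hm.le]
  have hpos : 0 < (m * ‖μ‖) ^ 2 := pow_pos (mul_pos hm (hε.trans hμ)) 2
  have hthreshold : (ε * q / 36) ^ 2 ≤ (1 / 12) ^ 2 * (m * ‖μ‖) ^ 2 := by
    rw [← mul_pow]
    gcongr
    nlinarith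
  have hanti := prod_abs_inner_le (sumLaw ν (parityIndices q 0)) (sumLaw ν (parityIndices q 1))
    (by rw [hmean, hmean, hinner]; exact hpos.ne') (s := 1 / 12) (by norm_num)
  rw [hmean, hmean, hinner, abs_of_pos hpos] at hanti
  calc Measure.pi (fun _ => ν) {x | |crossStatistic x| ≤ (ε * q / 36) ^ 2}
      = ((sumLaw ν (parityIndices q 0)).prod (sumLaw ν (parityIndices q 1)))
          {z | |inner ℝ z.1 z.2| ≤ (ε * q / 36) ^ 2} :=
        pi_crossStatistic ν (A := {r | |r| ≤ (ε * q / 36) ^ 2})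
          (measurableSet_le (by fun_prop) (by fun_prop))
    _ ≤ ENNReal.ofReal (4 * (1 / 12)) :=
        (measure_mono fun _ hz => le_trans hz hthreshold).trans hanti
    _ = 1 / 3 := by
        rw [← ofReal_one_third]
        norm_num

theorem meanTester_testsGaussianMean (hε : 0 < ε)
    (hq : 1296 * max 1 (√(n : ℝ) / ε ^ 2) ≤ q) :
    TestsGaussianMean n q ε fun ν b => ν (outputSet meanTester n q ε b) := by
  have hq1 : (1296 : ℝ) ≤ q := by linarith [le_max_left 1 (√(n : ℝ) / ε ^ 2)]
  have hqn : 1296 * √(n : ℝ) ≤ q * ε ^ 2 := by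
    rw [← div_le_iff₀ (by positivity), mul_div_assoc]
    linarith [le_max_right 1 (√(n : ℝ) / ε ^ 2)]
  simp only [TestsGaussianMean, outputSet_meanTester, decide_eq_true_eq, decide_eq_false_iff_not]
  refine ⟨?_, fun μ S _ hμ => ?_⟩
  · have hnull : 3 * (n * ((q / 2 : ℕ) : ℝ) ^ 2) ≤ ((ε * q / 36) ^ 2) ^ 2 := by
      have hm : ((q / 2 : ℕ) : ℝ) ≤ q / 2 := Nat.cast_div_le
      calc 3 * (n * ((q / 2 : ℕ) : ℝ) ^ 2)
          ≤ 3 * (n * (q / 2 : ℝ) ^ 2) := by gcongr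
        _ ≤ (1296 * √(n : ℝ)) ^ 2 * q ^ 2 / 1296 ^ 2 := by
          rw [mul_pow, Real.sq_sqrt (by positivity)]
          nlinarith [mul_nonneg (Nat.cast_nonneg (α := ℝ) n) (sq_nonneg (q : ℝ))]
        _ ≤ (q * ε ^ 2) ^ 2 * q ^ 2 / 1296 ^ 2 := by gcongr
        _ = ((ε * q / 36) ^ 2) ^ 2 := by ring
    have := two_thirds_le_measure_compl (measurableSet_lt (by fun_prop) (by fun_prop))
      (gaussianSamples_lt_abs_crossStatistic (by positivity) hnull)
    simpa only [Set.compl_ofPred, not_lt] using this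
  · have hq2 : 2 ≤ q := by
      rify
      linarith
    have := two_thirds_le_measure_compl (measurableSet_le (by fun_prop) (by fun_prop))
      (gaussianSamples_abs_crossStatistic_le S hq2 hε hμ)
    simpa only [Set.compl_ofPred] using this

end RealRAM

section Density

theorem map_withDensity_comp {α β : Type*} [MeasurableSpace α] [MeasurableSpace β]
    (P : Measure α) {f : α → β} (hf : Measurable f) {g : β → ℝ≥0∞} (hg : Measurable g) :
    (P.withDensity (g ∘ f)).map f = (P.map f).withDensity g := by
  ext s hs
  rw [Measure.map_apply hf hs, withDensity_apply _ (hf hs), withDensity_apply _ hs,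
    setLIntegral_map hs hg hf]
  rfl

theorem lintegral_pi_prod {ι : Type*} [Fintype ι] {Ω : ι → Type*} [∀ i, MeasurableSpace (Ω i)]
    (P : ∀ i, Measure (Ω i)) [∀ i, IsProbabilityMeasure (P i)] {f : ∀ i, Ω i → ℝ≥0∞}
    (hf : ∀ i, Measurable (f i)) :
    ∫⁻ x, ∏ i, f i (x i) ∂(Measure.pi P) = ∏ i, ∫⁻ y, f i y ∂(P i) := by
  rw [lintegral_prod_eq_prod_lintegral_of_indepFun Finset.univ (fun i (x : ∀ i, Ω i) => f i (x i))
    (iIndepFun_pi fun i => (hf i).aemeasurable) fun i => (hf i).comp (measurable_pi_apply i)]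
  exact Finset.prod_congr rfl fun i _ => (measurePreserving_eval P i).lintegral_comp (hf i)

theorem pi_withDensity {ι : Type*} [Fintype ι] {Ω : ι → Type*} [∀ i, MeasurableSpace (Ω i)]
    (P : ∀ i, Measure (Ω i)) [∀ i, IsProbabilityMeasure (P i)] {g : ∀ i, Ω i → ℝ≥0∞}
    (hg : ∀ i, Measurable (g i)) [∀ i, SigmaFinite ((P i).withDensity (g i))] :
    Measure.pi (fun i => (P i).withDensity (g i)) =
      (Measure.pi P).withDensity fun x => ∏ i, g i (x i) := by
  classical
  refine Measure.pi_eq fun s hs => ?_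
  have hindicator : (Set.univ.pi s).indicator (fun x => ∏ i, g i (x i)) =
      fun x => ∏ i, (s i).indicator (g i) (x i) := by
    ext x
    simp only [Set.indicator_apply, Finset.prod_ite_zero, Set.mem_univ_pi, Finset.mem_univ,
      true_imp_iff]
  rw [withDensity_apply _ (MeasurableSet.univ_pi hs),
    ← lintegral_indicator (MeasurableSet.univ_pi hs), hindicator,
    lintegral_pi_prod P fun i => (hg i).indicator (hs i)]
  refine Finset.prod_congr rfl fun i _ => ?_
  rw [withDensity_apply _ (hs i), lintegral_indicator (hs i)]

theorem gaussianReal_one_eq_withDensity (a : ℝ) :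
    gaussianReal a 1 =
      (gaussianReal 0 1).withDensity fun x => ENNReal.ofReal (Real.exp (a * x - a ^ 2 / 2)) := by
  rw [gaussianReal_of_var_ne_zero a one_ne_zero, gaussianReal_of_var_ne_zero 0 one_ne_zero,
    ← withDensity_mul _ (measurable_gaussianPDF 0 1) (by fun_prop)]
  congr 1
  ext x
  rw [Pi.mul_apply, gaussianPDF, gaussianPDF, ← ENNReal.ofReal_mul (gaussianPDFReal_nonneg _ _ _),
    gaussianPDFReal_def, gaussianPDFReal_def]
  simp only [NNReal.coe_one]
  rw [mul_assoc (√(2 * Real.pi * 1))⁻¹, ← Real.exp_add]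
  congr 3
  ring

variable {ι : Type*} [Fintype ι] [DecidableEq ι]

theorem multivariateGaussian_one_eq_map_pi (μ : EuclideanSpace ℝ ι) :
    multivariateGaussian μ 1 =
      (Measure.pi fun j => gaussianReal (μ j) 1).map (WithLp.toLp 2) := by
  have hshift : (fun x => μ + x) ∘ WithLp.toLp 2 =
      WithLp.toLp 2 ∘ fun (x : ι → ℝ) j => μ j + x j := by
    ext x j
    simp
  calc multivariateGaussian μ 1
      = (stdGaussian (EuclideanSpace ℝ ι)).map (fun x => μ + x) := by
        simp [multivariateGaussian]
    _ = (Measure.pi fun j => (gaussianReal 0 1).map fun y => μ j + y).map (WithLp.toLp 2) := by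
        rw [← map_pi_eq_stdGaussian, Measure.map_map (by fun_prop) (by fun_prop), hshift,
          ← Measure.map_map (by fun_prop) (by fun_prop),
          Measure.pi_map_pi (f := fun j y => μ j + y) fun j => by fun_prop]
    _ = (Measure.pi fun j => gaussianReal (μ j) 1).map (WithLp.toLp 2) := by
        simp only [gaussianReal_map_const_add, zero_add]

theorem multivariateGaussian_one_eq_withDensity (μ : EuclideanSpace ℝ ι) :
    multivariateGaussian μ 1 = (multivariateGaussian 0 1).withDensity
      fun x => ENNReal.ofReal (Real.exp (inner ℝ μ x - ‖μ‖ ^ 2 / 2)) := by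
  have hprod : (fun x : ι → ℝ => ∏ j, ENNReal.ofReal (Real.exp (μ j * x j - μ j ^ 2 / 2))) =
      (fun x => ENNReal.ofReal (Real.exp (inner ℝ μ x - ‖μ‖ ^ 2 / 2))) ∘ WithLp.toLp 2 := by
    ext x
    rw [← ENNReal.ofReal_prod_of_nonneg fun _ _ => (Real.exp_pos _).le, ← Real.exp_sum,
      Finset.sum_sub_distrib, Function.comp_apply, EuclideanSpace.real_norm_sq_eq,
      PiLp.inner_apply, Finset.sum_div]
    simp [mul_comm]
  have hdensity (j : ι) := gaussianReal_one_eq_withDensity (μ j)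
  have (j : ι) : SigmaFinite ((gaussianReal 0 1).withDensity
      fun x => ENNReal.ofReal (Real.exp (μ j * x - μ j ^ 2 / 2))) := hdensity j ▸ inferInstance
  simp only [multivariateGaussian_one_eq_map_pi, hdensity, PiLp.zero_apply]
  rw [pi_withDensity _ fun j => by fun_prop, hprod, map_withDensity_comp _ (by fun_prop)
    (by fun_prop)]

end Density

section Covariance

variable {Ω : Type*} [MeasurableSpace Ω] {P : Measure Ω}

theorem sq_covariance_le [IsFiniteMeasure P] {X Y : Ω → ℝ} (hX : MemLp X 2 P)
    (hY : MemLp Y 2 P) : cov[X, Y; P] ^ 2 ≤ Var[X; P] * Var[Y; P] := by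
  have hquadratic (t : ℝ) :
      0 ≤ Var[Y; P] * (t * t) + 2 * cov[X, Y; P] * t + Var[X; P] := by
    have := variance_nonneg (X + t • Y) P
    rw [variance_add hX (hY.const_smul t), variance_smul, covariance_smul_right] at this
    linarith
  have := discrim_le_zero hquadratic
  rw [discrim] at this
  linarith

theorem sq_card_mul_le_sum_covariance [IsProbabilityMeasure P] {ι : Type*} [Fintype ι]
    {f : Ω → ℝ} (hf : AEMeasurable f P) (hf01 : ∀ ω, f ω ∈ Set.Icc 0 1) {L : ι → Ω → ℝ}
    (hL : ∀ s, MemLp (L s) 2 P) {δ : ℝ} (hδ : 0 ≤ δ) (hgap : ∀ s, δ ≤ -cov[f, L s; P]) :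
    (Fintype.card ι * δ) ^ 2 ≤ 1 / 4 * ∑ s, ∑ s', cov[L s, L s'; P] := by
  have hf2 : MemLp f 2 P := memLp_of_bounded (.of_forall hf01) hf.aestronglyMeasurable 2
  have hsum : MemLp (∑ s, L s) 2 P := memLp_finsetSum' _ fun s _ => hL s
  have hvar : Var[f; P] ≤ 1 / 4 :=
    (variance_le_sq_of_bounded (.of_forall hf01) hf).trans_eq (by norm_num)
  calc (Fintype.card ι * δ) ^ 2
      ≤ (∑ s, -cov[f, L s; P]) ^ 2 := by
        gcongr
        simpa using Finset.sum_le_sum fun s (_ : s ∈ Finset.univ) => hgap s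
    _ = cov[f, ∑ s, L s; P] ^ 2 := by
        rw [covariance_sum_right hL hf2, Finset.sum_neg_distrib, neg_sq]
    _ ≤ Var[f; P] * Var[∑ s, L s; P] := sq_covariance_le hf2 hsum
    _ ≤ 1 / 4 * Var[∑ s, L s; P] := by gcongr; exact variance_nonneg _ _
    _ = 1 / 4 * ∑ s, ∑ s', cov[L s, L s'; P] := by
        rw [← covariance_self hsum.aemeasurable, covariance_sum_sum hL hL]

end Covariance

/-- The density of `gaussianSamples n q μ 1` with respect to `gaussianSamples n q 0 1`. -/
noncomputable def likelihoodRatio {n q : ℕ} (μ : EuclideanSpace ℝ (Fin n))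
    (x : Fin q → EuclideanSpace ℝ (Fin n)) : ℝ :=
  Real.exp (∑ i, (inner ℝ μ (x i) - ‖μ‖ ^ 2 / 2))

section LikelihoodRatio

variable {n q : ℕ} (μ μ' : EuclideanSpace ℝ (Fin n))

@[fun_prop]
theorem measurable_likelihoodRatio : Measurable (likelihoodRatio (q := q) μ) := by
  unfold likelihoodRatio
  fun_prop

theorem likelihoodRatio_pos (x : Fin q → EuclideanSpace ℝ (Fin n)) : 0 < likelihoodRatio μ x :=
  Real.exp_pos _

theorem gaussianSamples_one_eq_withDensity :
    gaussianSamples n q μ 1 = (gaussianSamples n q 0 1).withDensity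
      fun x => ENNReal.ofReal (likelihoodRatio μ x) := by
  have hdensity := multivariateGaussian_one_eq_withDensity μ
  have : SigmaFinite ((multivariateGaussian 0 1).withDensity
      fun x => ENNReal.ofReal (Real.exp (inner ℝ μ x - ‖μ‖ ^ 2 / 2))) := hdensity ▸ inferInstance
  rw [gaussianSamples, hdensity, pi_withDensity _ fun _ => by fun_prop]
  simp only [← ENNReal.ofReal_prod_of_nonneg fun _ _ => (Real.exp_pos _).le, ← Real.exp_sum]
  rfl

theorem integral_gaussianSamples_one (f : (Fin q → EuclideanSpace ℝ (Fin n)) → ℝ) :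
    ∫ x, f x ∂(gaussianSamples n q μ 1) =
      ∫ x, f x * likelihoodRatio μ x ∂(gaussianSamples n q 0 1) := by
  rw [gaussianSamples_one_eq_withDensity, integral_withDensity_eq_integral_toReal_smul
    (by fun_prop) (.of_forall fun _ => ENNReal.ofReal_lt_top)]
  simp [ENNReal.toReal_ofReal (likelihoodRatio_pos μ _).le, mul_comm]

theorem integral_likelihoodRatio :
    ∫ x, likelihoodRatio μ x ∂(gaussianSamples n q 0 1) = 1 := by
  simpa using (integral_gaussianSamples_one (q := q) μ 1).symm

theorem likelihoodRatio_mul (x : Fin q → EuclideanSpace ℝ (Fin n)) :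
    likelihoodRatio μ x * likelihoodRatio μ' x =
      Real.exp (q * inner ℝ μ μ') * likelihoodRatio (μ + μ') x := by
  have hinner : (q : ℝ) * inner ℝ μ μ' = ∑ _i : Fin q, inner ℝ μ μ' := by simp
  simp only [likelihoodRatio, ← Real.exp_add, hinner, ← Finset.sum_add_distrib]
  congr 1
  refine Finset.sum_congr rfl fun i _ => ?_
  rw [norm_add_sq_real, inner_add_left]
  ring

theorem memLp_two_likelihoodRatio : MemLp (likelihoodRatio μ) 2 (gaussianSamples n q 0 1) := by
  refine (memLp_two_iff_integrable_sq (by fun_prop)).2 ?_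
  simp only [sq, likelihoodRatio_mul]
  refine (Integrable.of_integral_ne_zero ?_).const_mul _
  rw [integral_likelihoodRatio]
  exact one_ne_zero

theorem covariance_likelihoodRatio :
    cov[likelihoodRatio μ, likelihoodRatio μ'; gaussianSamples n q 0 1] =
      Real.exp (q * inner ℝ μ μ') - 1 := by
  rw [covariance_eq_sub (memLp_two_likelihoodRatio μ) (memLp_two_likelihoodRatio μ'),
    integral_likelihoodRatio, integral_likelihoodRatio, mul_one]
  simp only [Pi.mul_apply, likelihoodRatio_mul, integral_const_mul, integral_likelihoodRatio,
    mul_one]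

theorem covariance_likelihoodRatio_right {f : (Fin q → EuclideanSpace ℝ (Fin n)) → ℝ}
    (hf : MemLp f 2 (gaussianSamples n q 0 1)) :
    cov[f, likelihoodRatio μ; gaussianSamples n q 0 1] =
      ∫ x, f x ∂(gaussianSamples n q μ 1) - ∫ x, f x ∂(gaussianSamples n q 0 1) := by
  rw [covariance_eq_sub hf (memLp_two_likelihoodRatio μ), integral_likelihoodRatio, mul_one,
    integral_gaussianSamples_one μ]
  rfl

end LikelihoodRatio

/-- The vector with entries `± η`, the signs being given by `s`. -/
noncomputable def signVector {ι : Type*} (η : ℝ) (s : ι → Bool) : EuclideanSpace ℝ ι :=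
  WithLp.toLp 2 fun j => if s j then η else -η

section SignVector

variable {ι : Type*} [Fintype ι]

theorem norm_signVector_sq (η : ℝ) (s : ι → Bool) :
    ‖signVector η s‖ ^ 2 = Fintype.card ι * η ^ 2 := by
  have hentry (j : ι) : signVector η s j ^ 2 = η ^ 2 := by
    simp only [signVector]
    split_ifs <;> ring
  simp [EuclideanSpace.real_norm_sq_eq, hentry]

theorem sum_exp_inner_signVector [DecidableEq ι] (η r : ℝ) (s : ι → Bool) :
    ∑ s' : ι → Bool, Real.exp (r * inner ℝ (signVector η s) (signVector η s')) =
      (2 * Real.cosh (r * η ^ 2)) ^ Fintype.card ι := by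
  let a (b : Bool) : ℝ := if b then η else -η
  have hcosh (b : Bool) : ∑ b', Real.exp (r * (a b * a b')) = 2 * Real.cosh (r * η ^ 2) := by
    rw [Real.cosh_eq, Fintype.sum_bool]
    cases b <;> simp only [a, if_true, if_false, Bool.false_eq_true] <;> ring_nf
  calc ∑ s' : ι → Bool, Real.exp (r * inner ℝ (signVector η s) (signVector η s'))
      = ∑ s' : ι → Bool, ∏ j, Real.exp (r * (a (s j) * a (s' j))) := by
        refine Finset.sum_congr rfl fun s' _ => ?_
        rw [← Real.exp_sum, PiLp.inner_apply, Finset.mul_sum]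
        simp [signVector, a, mul_comm]
    _ = ∏ j, ∑ b', Real.exp (r * (a (s j) * a b')) := by
        rw [Finset.prod_univ_sum, Fintype.piFinset_univ]
    _ = (2 * Real.cosh (r * η ^ 2)) ^ Fintype.card ι := by
        simp only [hcosh, Finset.prod_const, Finset.card_univ]

end SignVector

theorem measureReal_bind {α β : Type*} [MeasurableSpace α] [MeasurableSpace β] (P : Measure α)
    (κ : Kernel α β) [IsFiniteKernel κ] {A : Set β} (hA : MeasurableSet A) :
    (P.bind κ).real A = ∫ x, (κ x).real A ∂P := by
  rw [measureReal_def, Measure.bind_apply hA κ.aemeasurable]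
  exact (integral_toReal (κ.measurable_coe hA).aemeasurable
    (.of_forall fun x => measure_lt_top _ _)).symm

section LowerBound

variable {n q : ℕ} {ε : ℝ}
  {κ : Kernel (Fin q → EuclideanSpace ℝ (Fin n)) Bool} [IsMarkovKernel κ]

theorem integral_accept_gap (h : TestsGaussianMean n q ε fun ν b => (ν.bind κ) {b})
    {μ : EuclideanSpace ℝ (Fin n)} (hμ : ε < ‖μ‖) :
    1 / 3 ≤ ∫ x, (κ x).real {true} ∂(gaussianSamples n q 0 1) -
      ∫ x, (κ x).real {true} ∂(gaussianSamples n q μ 1) := by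
  have toReal_le {p : ℝ≥0∞} (hp : p ≠ ⊤) (h : 2 / 3 ≤ p) : 2 / 3 ≤ p.toReal := by
    simpa using ENNReal.toReal_mono hp h
  rw [← measureReal_bind _ _ (.singleton _), ← measureReal_bind _ _ (.singleton _)]
  have haccept := toReal_le (measure_ne_top _ _) h.1
  have hreject := toReal_le (measure_ne_top _ _) (h.2 μ 1 .one hμ)
  have hsum := probReal_compl_eq_one_sub (μ := (gaussianSamples n q μ 1).bind κ)
    (.singleton false)
  rw [show ({false} : Set Bool)ᶜ = {true} by ext b; cases b <;> simp] at hsum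
  rw [hsum]
  simp only [measureReal_def]
  linarith

theorem sum_exp_inner_ge_of_testsGaussianMean {ι : Type*} [Fintype ι]
    (h : TestsGaussianMean n q ε fun ν b => (ν.bind κ) {b})
    {μ : ι → EuclideanSpace ℝ (Fin n)} (hμ : ∀ s, ε < ‖μ s‖) :
    13 / 9 * (Fintype.card ι : ℝ) ^ 2 ≤ ∑ s, ∑ s', Real.exp (q * inner ℝ (μ s) (μ s')) := by
  have hf : Measurable fun x => (κ x).real {true} :=
    (κ.measurable_coe (.singleton true)).ennreal_toReal
  have hf01 (x) : (κ x).real {true} ∈ Set.Icc 0 1 := ⟨measureReal_nonneg, measureReal_le_one⟩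
  have hf2 : MemLp (fun x => (κ x).real {true}) 2 (gaussianSamples n q 0 1) :=
    memLp_of_bounded (.of_forall hf01) hf.aestronglyMeasurable 2
  have hgap (s : ι) : 1 / 3 ≤ -cov[fun x => (κ x).real {true}, likelihoodRatio (μ s);
      gaussianSamples n q 0 1] := by
    rw [covariance_likelihoodRatio_right _ hf2, neg_sub]
    exact integral_accept_gap h (hμ s)
  have := sq_card_mul_le_sum_covariance hf.aemeasurable hf01
    (fun s => memLp_two_likelihoodRatio (μ s)) (by norm_num) hgap
  simp only [covariance_likelihoodRatio, Finset.sum_sub_distrib, Finset.sum_const,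
    Finset.card_univ, nsmul_eq_mul, mul_one] at this
  linarith

theorem le_exp_of_testsGaussianMean (hn : 1 ≤ n) (hε : 0 < ε)
    (h : TestsGaussianMean n q ε fun ν b => (ν.bind κ) {b}) :
    13 / 9 ≤ Real.exp (8 * (q * ε ^ 2) ^ 2 / n) := by
  have hn0 : (0 : ℝ) < n := by exact_mod_cast hn
  set η : ℝ := 2 * ε / √(n : ℝ) with hη
  have hη2 : η ^ 2 = 4 * ε ^ 2 / n := by
    rw [hη, div_pow, Real.sq_sqrt hn0.le]
    ring
  have hnorm (s : Fin n → Bool) : ε < ‖signVector η s‖ := by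
    refine lt_of_pow_lt_pow_left₀ 2 (norm_nonneg _) ?_
    rw [norm_signVector_sq, hη2, Fintype.card_fin, mul_div_cancel₀ _ hn0.ne']
    nlinarith [sq_pos_of_pos hε]
  have hsum := sum_exp_inner_ge_of_testsGaussianMean h hnorm
  simp only [sum_exp_inner_signVector, Finset.sum_const, Finset.card_univ, nsmul_eq_mul,
    Fintype.card_pi, Fintype.card_bool, Finset.prod_const, Fintype.card_fin, mul_pow,
    Nat.cast_pow, Nat.cast_ofNat] at hsum
  have hcosh : 13 / 9 ≤ Real.cosh (q * η ^ 2) ^ n := by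
    refine le_of_mul_le_mul_left ?_ (by positivity : (0 : ℝ) < (2 ^ n) ^ 2)
    linarith
  calc 13 / 9 ≤ Real.cosh (q * η ^ 2) ^ n := hcosh
    _ ≤ Real.exp ((q * η ^ 2) ^ 2 / 2) ^ n := by
      gcongr
      exact Real.cosh_le_exp_half_sq _
    _ = Real.exp (8 * (q * ε ^ 2) ^ 2 / n) := by
      rw [← Real.exp_nat_mul, hη2]
      congr 1
      field_simp
      ring

theorem sample_lower_bound (hn : 1 ≤ n) (hε : 0 < ε)
    (h : TestsGaussianMean n q ε fun ν b => (ν.bind κ) {b}) :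
    1 / 6 * max 1 (√(n : ℝ) / ε ^ 2) ≤ q := by
  have hn1 : (1 : ℝ) ≤ n := by exact_mod_cast hn
  have hlog : (4 : ℝ) / 13 ≤ 8 * (q * ε ^ 2) ^ 2 / n := by
    have := Real.one_sub_inv_le_log_of_pos (by norm_num : (0 : ℝ) < 13 / 9)
    have := (Real.log_le_iff_le_exp (by norm_num)).2 (le_exp_of_testsGaussianMean hn hε h)
    linarith
  have hsqrt : √(n : ℝ) ≤ 6 * (q * ε ^ 2) := by
    rw [le_div_iff₀ (by positivity)] at hlog
    exact (Real.sqrt_le_left (by positivity)).2 (by nlinarith)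
  have hq : (1 : ℝ) ≤ q := by
    refine Nat.one_le_cast.2 (Nat.pos_of_ne_zero fun hq => ?_)
    rw [hq, Nat.cast_zero, zero_mul, mul_zero] at hsqrt
    linarith [Real.one_le_sqrt.2 hn1]
  rw [mul_max_of_nonneg _ _ (by norm_num), max_le_iff, ← mul_div_assoc,
    div_le_iff₀ (by positivity)]
  exact ⟨by linarith, by linarith⟩

end LowerBound

section RunningTime

variable {n : ℕ}

theorem le_three_mul_rpow_log (hn : 1 ≤ n) : (n : ℝ) ≤ 3 * (n : ℝ) ^ Real.log n := by
  have hn0 : (0 : ℝ) < n := by exact_mod_cast hn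
  calc (n : ℝ) = Real.exp (Real.log n) := (Real.exp_log hn0).symm
    _ ≤ Real.exp (1 + Real.log n * Real.log n) := by
      gcongr
      nlinarith [sq_nonneg (Real.log n - 1 / 2)]
    _ = Real.exp 1 * (n : ℝ) ^ Real.log n := by rw [Real.exp_add, Real.rpow_def_of_pos hn0]
    _ ≤ 3 * (n : ℝ) ^ Real.log n := by
      gcongr
      exact Real.exp_one_lt_three.le

theorem mul_succ_mul_le_pow_rpow_log (hn : 1 ≤ n) (q K : ℕ) :
    (K : ℝ) * ((q + 1) * n) ≤ (3 * K + 2) * (q + (n : ℝ) ^ Real.log n) ^ (3 * K + 2) := by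
  have hN : 1 ≤ (n : ℝ) ^ Real.log n :=
    Real.one_le_rpow (by exact_mod_cast hn) (Real.log_natCast_nonneg n)
  have hnN := le_three_mul_rpow_log hn
  set N := (n : ℝ) ^ Real.log n
  have : (0 : ℝ) ≤ q := q.cast_nonneg
  calc (K : ℝ) * ((q + 1) * n) ≤ K * ((q + N) * (3 * (q + N))) := by gcongr; linarith
    _ = 3 * K * (q + N) ^ 2 := by ring
    _ ≤ (3 * K + 2) * (q + N) ^ (3 * K + 2) := by
      gcongr
      · linarith
      · linarith
      · lia

end RunningTime

theorem one_le_sqrt_div_sq {n : ℕ} {ε : ℝ} (hn : 1 ≤ n) (hε : 0 < ε) (hε1 : ε ≤ 1) :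
    1 ≤ √(n : ℝ) / ε ^ 2 := by
  rw [one_le_div (by positivity)]
  exact (pow_le_one₀ hε.le hε1).trans (Real.one_le_sqrt.2 (by exact_mod_cast hn))

theorem theorem4p9_general :
    (∃ (P : RealRAM.Prog) (C : ℝ) (K : ℕ), 0 < C ∧
      ∀ (n q : ℕ) (ε : ℝ), 1 ≤ n → 0 < ε →
        (∀ x : Fin q → EuclideanSpace ℝ (Fin n), ∃ (b : Bool) (t : ℕ),
          RealRAM.OutputsIn P n q ε x b t ∧ t ≤ K * ((q + 1) * n)) ∧
        (C * max 1 (√(n : ℝ) / ε ^ 2) ≤ q →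
          TestsGaussianMean n q ε fun ν b => ν (RealRAM.outputSet P n q ε b))) ∧
    (∃ c : ℝ, 0 < c ∧
      ∀ (n q : ℕ) (ε : ℝ), 1 ≤ n → 0 < ε →
        ∀ κ : Kernel (Fin q → EuclideanSpace ℝ (Fin n)) Bool, IsMarkovKernel κ →
          (TestsGaussianMean n q ε fun ν b => (ν.bind κ) {b}) →
          c * max 1 (√(n : ℝ) / ε ^ 2) ≤ q) := by
  refine ⟨⟨RealRAM.meanTester, 1296, 27, by norm_num, fun n q ε hn hε => ⟨fun x =>
    ⟨_, _, RealRAM.meanTester_outputsIn n q ε x, ?_⟩,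
    RealRAM.meanTester_testsGaussianMean hε⟩⟩,
    1 / 6, by norm_num, fun n q ε hn hε κ _ => sample_lower_bound hn hε⟩
  calc (9 * (q / 2) + 12) * n + 15 ≤ (9 * q + 12) * n + 15 * n := by
        gcongr
        · exact Nat.div_le_self q 2
        · lia
    _ ≤ 27 * ((q + 1) * n) := by nlinarith

theorem theorem4p9 :
    -- the algorithm: one program for all `n`, `q`, `ε`
    (∃ (P : RealRAM.Prog) (C : ℝ) (K : ℕ), 0 < C ∧
      ∀ (n q : ℕ) (ε : ℝ), 1 ≤ n → 0 < ε → ε ≤ 1 →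
        -- running time, on every input
        (∀ x : Fin q → EuclideanSpace ℝ (Fin n), ∃ (b : Bool) (t : ℕ),
          RealRAM.OutputsIn P n q ε x b t ∧
          (t : ℝ) ≤ K * ((q : ℝ) + (n : ℝ) ^ Real.log n) ^ K) ∧
        -- correctness
        (C * (√(n : ℝ) / ε ^ 2) ≤ q →
          TestsGaussianMean n q ε fun ν b => ν (RealRAM.outputSet P n q ε b))) ∧
    -- the lower bound, for arbitrary randomized procedures
    (∃ c : ℝ, 0 < c ∧
      ∀ (n q : ℕ) (ε : ℝ), 1 ≤ n → 0 < ε → ε ≤ 1 →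
        ∀ κ : ProbabilityTheory.Kernel (Fin q → EuclideanSpace ℝ (Fin n)) Bool,
          ProbabilityTheory.IsMarkovKernel κ →
          (TestsGaussianMean n q ε fun ν b => (ν.bind κ) {b}) →
          c * (√(n : ℝ) / ε ^ 2) ≤ q) := by
  obtain ⟨⟨P, C, K, hC, hP⟩, c, hc, hbound⟩ := theorem4p9_general
  refine ⟨⟨P, C, 3 * K + 2, hC, fun n q ε hn hε hε1 => ?_⟩, c, hc,
    fun n q ε hn hε hε1 κ hκ hκtest => ?_⟩
  · obtain ⟨htime, htest⟩ := hP n q ε hn hε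
    refine ⟨fun x => ?_, fun hq => htest ?_⟩
    · obtain ⟨b, t, hout, ht⟩ := htime x
      refine ⟨b, t, hout, ?_⟩
      push_cast
      exact le_trans (by exact_mod_cast ht) (mul_succ_mul_le_pow_rpow_log hn q K)
    · rwa [max_eq_right (one_le_sqrt_div_sq hn hε hε1)]
  · have := hbound n q ε hn hε κ hκ hκtest
    rwa [max_eq_right (one_le_sqrt_div_sq hn hε hε1)] at this
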